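/- **Setting.** Let $\mathcal X$ be a measurable space, $k\ge 1$ an integer, $\gamma\in(0,1)$, and let $\mathcal H\subseteq[0,1]^{\mathcal X}$ be a class of (measurable) functions. $\mathcal H$ $(\gamma,k)$-fat-shatters a sequence $(x_1,\dots,x_d)\in\mathcal X^d$ if there are $c_1,\dots,c_d\in[0,1]^k$ with $c_{i,j+1}\ge c_{i,j}+2\gamma$ for all $i\le d$ and $1\le j\le k-1$, such that for every $b\in\{0,1,\dots,k\}^d$ there is $h_b\in\mathcal H$ such that for every $i$: $h_b(x_i)\le c_{i,1}-\gamma$ if $b_i=0$; $c_{i,b_i}+\gamma\le h_b(x_i)\le c_{i,b_i+1}-\gamma$ if $0<b_i<k$; and $c_{i,k}+\gamma\le h_b(x_i)$ if $b_i=k$. The $(\gamma,k)$-fat-shattering dimension $\mathbb D^{\mathrm{fat}}_{\gamma,k}(\mathcal H)\in\mathbb N\cup\{\infty\}$ is the supremum of the lengths of $(\gamma,k)$-fat-shattered sequences ($0$ if there are none). For a distribution $\mathcal D$ on $\mathcal X\times[0,1]$ and $\mu:\mathcal X\to[0,1]^k$ (or $\mu = h:\mathcal X\to[0,1]$, regarded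 as a list hypothesis with lists of length one) put $\mathrm{err}_{\mathcal D}(\mu)=\mathbb E_{(x,y)\sim\mathcal D}\min_j|\mu(x)_j-y|$. A $k$-list regression algorithm $\mathcal A$ maps a finite sample of points of $\mathcal X\times[0,1]$, using internal randomness, to a $k$-list hypothesis $\mu:\mathcal X\to[0,1]^k$. It agnostically learns $\mathcal H$ to accuracy $\varepsilon$ and confidence $\delta$ with sample complexity $m$ if for every distribution $\mathcal D$ on $\mathcal X\times[0,1]$ and every $n\ge m$, given a sample $S$ of $n$ i.i.d. examples from $\mathcal D$, with probability at least $1-\delta$ over $S$ and the randomness of $\mathcal A$, $$\mathrm{err}_{\mathcal D}(\mathcal A(S))\le\inf_{h\in\mathcal H}\mathrm{err}_{\mathcal D}(h)+\varepsilon .$$ **Theorem.** There are universal constants $C>0$ and $p\in\mathbb N$ such that the following holds for all $\mathcal X,\mathcal H,k,\gamma$ as above. Let $\varepsilon,\delta\in(0,1)$ satisfy $\varepsilon,\delta\le\frac{\gamma}{8(k+1)}$, and let $\mathcal A$ be any (possibly randomized) $k$-list regression algorithm that agnostically learns $\mathcal H$ to accuracy $\varepsilon$ and confidence $\delta$ with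 sample complexity $m\in\mathbb N$. Then $d=\mathbb D^{\mathrm{fat}}_{\gamma,k}(\mathcal H)$ is finite and $$m\;\ge\;\frac{C}{\bigl(\log(2+dk/\gamma)\bigr)^{p}}\cdot\frac{d}{k^k},$$ that is, $m\ge\widetilde\Omega\bigl(d/k^k\bigr)$, where $\widetilde\Omega$ hides factors polylogarithmic in $d$, $k$ and $1/\gamma$. In particular this holds for the sample complexity function of every agnostic $k$-list learner of $\mathcal H$, and if $d=\infty$ there is no algorithm with such a guarantee at $(\varepsilon,\delta)$. -/

import Mathlib

open MeasureTheory
open scoped ENNReal unitInterval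

noncomputable section

namespace ListRegression

/-- A class `H ⊆ [0,1]^X` `(γ,k)`-fat-shatters the sequence `x = (x_1, …, x_d)`.
The anchors are indexed from `0`, so `c i j` is the usual `c_{i,j+1}`: the label `h (x i)` must lie
at least `γ` above `c_{i,b_i}` (no condition if `b_i = 0`) and at least `γ` below `c_{i,b_i+1}`
(no condition if `b_i = k`). -/
def FatShatters {X : Type*} (H : Set (X → I)) (γ : ℝ) (k : ℕ) {d : ℕ} (x : Fin d → X) : Prop :=
  ∃ c : Fin d → Fin k → I,
    (∀ i, ∀ j j' : Fin k, (j' : ℕ) = j + 1 → (c i j : ℝ) + 2 * γ ≤ c i j') ∧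
    ∀ b : Fin d → Fin (k + 1), ∃ h ∈ H, ∀ i, ∀ j : Fin k,
      ((b i : ℕ) = j + 1 → (c i j : ℝ) + γ ≤ h (x i)) ∧
      ((b i : ℕ) = j → (h (x i) : ℝ) ≤ c i j - γ)

/-- The `(γ,k)`-fat-shattering dimension: the supremum of the lengths of the
`(γ,k)`-fat-shattered sequences (`⊤` if there are arbitrarily long ones). -/
def fatDim {X : Type*} (H : Set (X → I)) (γ : ℝ) (k : ℕ) : ℕ∞ :=
  ⨆ (d : ℕ) (_ : ∃ x : Fin d → X, FatShatters H γ k x), (d : ℕ∞)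

/-- The absolute loss of a `k`-list: `min_j |μ_j - y|` (for `k ≥ 1`). -/
def listLoss {k : ℕ} (μ : Fin k → I) (y : I) : ℝ :=
  ⨅ j : Fin k, |(μ j : ℝ) - y|

/-- The expected loss `E_{(x,y) ∼ D} ℓ(μ(x), y)` of a list hypothesis `μ`. -/
def listErr {X : Type*} [MeasurableSpace X] {k : ℕ} (D : Measure (X × I)) (μ : X → Fin k → I) :
    ℝ≥0∞ :=
  ∫⁻ p, ENNReal.ofReal (listLoss (μ p.1) p.2) ∂D

/-- The best expected loss `inf_{h ∈ H} E_{(x,y) ∼ D} |h(x) - y|` in the class, each `h` being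
regarded as a list hypothesis with lists of length `1`. -/
def bestErr {X : Type*} [MeasurableSpace X] (H : Set (X → I)) (D : Measure (X × I)) : ℝ≥0∞ :=
  ⨅ h ∈ H, listErr D (fun x (_ : Fin 1) => h x)

/-- A (possibly randomized) `k`-list learning algorithm: given a sample of any size `n` and a
random seed `ω : Ω`, it outputs a (measurable) hypothesis that maps points to lists of `k` labels. -/
structure ListAlgorithm (X : Type*) [MeasurableSpace X] (Ω : Type*) (k : ℕ) where
  /-- The hypothesis that is output on a given sample and a given random seed. -/
  output : (n : ℕ) → (Fin n → X × I) → Ω → X → Fin k → I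
  measurable_output : ∀ n S ω, Measurable (output n S ω)

/-- The agnostic guarantee of `A` for `H` at accuracy `ε` and confidence `δ` with sample size `m`:
for every distribution `D` on `X × [0,1]`, given at least `m` i.i.d. examples from `D`, the output
of `A` has expected loss at most `inf_{h ∈ H} err_D(h) + ε`, except with probability at most `δ`
over the sample and the internal randomness (of law `P`) of `A`. -/
def AgnosticGuarantee {X Ω : Type*} [MeasurableSpace X] [MeasurableSpace Ω] {k : ℕ}
    (H : Set (X → I)) (P : Measure Ω) (A : ListAlgorithm X Ω k) (ε δ : ℝ) (m : ℕ) : Prop :=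
  ∀ n : ℕ, m ≤ n → ∀ D : Measure (X × I), IsProbabilityMeasure D →
    ((Measure.pi fun _ : Fin n => D).prod P)
      {q | ¬ listErr D (A.output n q.1 q.2) ≤ bestErr H D + ENNReal.ofReal ε} ≤ ENNReal.ofReal δ

end ListRegression

end

namespace ListRegression

/-! The bound is an information count. On a shattered sequence of length `d`, each word `b` of cells
gives the uniform distribution on the points `x i` labelled by `h b`. The exact values of `h b`
could encode all of `b`, so labels are rounded to a grid of mesh `1 / N`, of order `γ / k`. Each
example then carries one of `N + 1` labels, and `h b` still has error at most `1 / N`, which the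
agnostic guarantee tolerates.

Averaging over `b` (`exists_positions_seed`) fixes the sampled positions and the seed so that the
learner succeeds for all but a `δ`-fraction of words. It now has at most `(N + 1) ^ m` outputs. At
each point a `k`-list misses one of the `k + 1` cells (`exists_missed_cell`), so success forces `b`
to agree with the word of missed cells well below the expected `d / (k + 1)` times. By Chernoff
(`ncard_agreement_le`) this holds for an exponentially small fraction of words. Hence `1 - δ ≤ (N +
1) ^ m * exp (-d / (3 (k + 1)))`, and logarithms give the result. -/

/-- If every one of finitely many sets has (outer) measure at most `a`, some point lies in at most
an `a`-fraction of them. No measurability is needed. -/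
lemma exists_card_filter_mem_le {W B : Type*} [MeasurableSpace W] [Fintype B]
    (Q : Measure W) [IsProbabilityMeasure Q] (E : B → Set W) {a : ℝ≥0∞} (hE : ∀ b, Q (E b) ≤ a) :
    ∃ w, ({b | w ∈ E b}.ncard : ℝ≥0∞) ≤ Fintype.card B * a := by
  classical
  -- Measurable hulls have the same measure, so the first-moment argument applies to arbitrary sets.
  let T : B → Set W := fun b => toMeasurable Q (E b)
  have hT : ∀ b, MeasurableSet (T b) := fun b => measurableSet_toMeasurable _ _
  have hm : Measurable fun w => ∑ b, (T b).indicator (1 : W → ℝ≥0∞) w :=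
    Finset.measurable_fun_sum _ fun b _ => measurable_one.indicator (hT b)
  obtain ⟨w, hw⟩ := exists_le_lintegral (μ := Q) hm.aemeasurable
  refine ⟨w, ?_⟩
  have hint : ∫⁻ w, ∑ b, (T b).indicator (1 : W → ℝ≥0∞) w ∂Q ≤ Fintype.card B * a := by
    rw [lintegral_finsetSum _ fun b _ => measurable_one.indicator (hT b)]
    calc ∑ b, ∫⁻ w, (T b).indicator (1 : W → ℝ≥0∞) w ∂Q ≤ ∑ _b : B, a := by
          refine Finset.sum_le_sum fun b _ => ?_
          rw [lintegral_indicator_one (hT b), measure_toMeasurable]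
          exact hE b
      _ = Fintype.card B * a := by simp
  refine le_trans ?_ (hw.trans hint)
  have hcard : ({b | w ∈ E b}.ncard : ℝ≥0∞) = ∑ b, if w ∈ E b then 1 else 0 := by
    rw [Finset.sum_boole, Set.ncard_eq_toFinset_card']
    simp
  rw [hcard]
  refine Finset.sum_le_sum fun b _ => ?_
  split_ifs with h
  · simp [Set.indicator_of_mem (show w ∈ T b from subset_toMeasurable _ _ h)]
  · exact zero_le

/-! ### Combinatorics of words and missed cells -/

/-- Chernoff bound for the number of coordinates at which a uniformly random word agrees with a
given word `v`. -/
lemma ncard_agreement_le (d k : ℕ) (v : Fin d → Fin (k + 1)) :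
    (({b : Fin d → Fin (k + 1) |
      (({i | b i = v i} : Finset (Fin d)).card : ℝ) ≤ 4 / 15 * (d / (k + 1))}.ncard : ℕ) : ℝ) ≤
      (k + 1) ^ d * Real.exp (-(d / (3 * (k + 1)))) := by
  classical
  have hk : (0 : ℝ) < k + 1 := by positivity
  set a : ℝ := 4 / 15 * (d / (k + 1)) with ha
  set G : Finset (Fin d → Fin (k + 1)) :=
    {b | (({i | b i = v i} : Finset (Fin d)).card : ℝ) ≤ a} with hG
  have hset : {b : Fin d → Fin (k + 1) |
      (({i | b i = v i} : Finset (Fin d)).card : ℝ) ≤ a}.ncard = G.card := by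
    rw [← Set.ncard_coe_finset]
    simp [hG]
  rw [hset]
  have hprod : ∀ b : Fin d → Fin (k + 1), ∏ i, (if b i = v i then Real.exp (-1) else 1) =
      Real.exp (-(({i | b i = v i} : Finset (Fin d)).card : ℝ)) := by
    intro b
    rw [Finset.prod_ite, Finset.prod_const, Finset.prod_const_one, mul_one, ← Real.exp_nat_mul]
    simp
  -- The exponential moment at parameter `-1` factorises: in each coordinate one letter has weight
  -- `exp (-1)` and the other `k` have weight `1`.
  have hsum : ∑ b : Fin d → Fin (k + 1), ∏ i, (if b i = v i then Real.exp (-1) else 1) =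
      (k + Real.exp (-1)) ^ d := by
    rw [← Fintype.prod_sum fun i (j : Fin (k + 1)) => if j = v i then Real.exp (-1) else 1]
    have : ∀ i, ∑ j : Fin (k + 1), (if j = v i then Real.exp (-1) else 1) = k + Real.exp (-1) := by
      intro i
      rw [← Finset.add_sum_erase _ _ (Finset.mem_univ (v i)),
        Finset.sum_congr rfl (g := fun _ => (1 : ℝ)) fun j hj => if_neg (Finset.ne_of_mem_erase hj)]
      simp [Finset.card_erase_of_mem, add_comm]
    simp [this]
  have h1 : (G.card : ℝ) * Real.exp (-a) ≤ (k + Real.exp (-1)) ^ d := by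
    rw [← hsum, ← nsmul_eq_mul]
    calc G.card • Real.exp (-a)
        ≤ ∑ b ∈ G, ∏ i, (if b i = v i then Real.exp (-1) else 1) := by
          refine Finset.card_nsmul_le_sum _ _ _ fun b hb => ?_
          rw [hprod, Real.exp_le_exp]
          have := (Finset.mem_filter.1 hb).2
          linarith
      _ ≤ _ := Finset.sum_le_sum_of_subset_of_nonneg (Finset.subset_univ _)
          fun b _ _ => by rw [hprod]; positivity
  -- This gives `1 - exp (-1) ≥ 3 / 5`; the final exponent is `3 / 5 - 4 / 15 = 1 / 3`.
  have he : Real.exp (-1) ≤ 2 / 5 := by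
    rw [Real.exp_neg, inv_le_comm₀ (Real.exp_pos _) (by norm_num)]
    have := Real.exp_one_gt_d9
    norm_num at this ⊢
    linarith
  have h2 : (k + Real.exp (-1)) ≤ (k + 1) * Real.exp (-(3 / 5 / (k + 1))) := by
    calc (k + Real.exp (-1)) ≤ (k + 1) * (-(3 / 5 / (k + 1)) + 1) := by
          field_simp
          linarith
      _ ≤ _ := by gcongr; exact Real.add_one_le_exp _
  have h3 : (k + Real.exp (-1)) ^ d ≤ (k + 1) ^ d * Real.exp (-(d * (3 / 5 / (k + 1)))) := by
    calc (k + Real.exp (-1)) ^ d ≤ ((k + 1) * Real.exp (-(3 / 5 / (k + 1)))) ^ d := by gcongr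
      _ = _ := by rw [mul_pow, ← Real.exp_nat_mul, mul_neg]
  calc (G.card : ℝ) = G.card * Real.exp (-a) * Real.exp a := by
        rw [mul_assoc, ← Real.exp_add]; simp
    _ ≤ (k + 1) ^ d * Real.exp (-(d * (3 / 5 / (k + 1)))) * Real.exp a := by
        exact mul_le_mul_of_nonneg_right (h1.trans h3) (Real.exp_pos a).le
    _ = (k + 1) ^ d * Real.exp (-(d / (3 * (k + 1)))) := by
        rw [mul_assoc, ← Real.exp_add]
        congr 2
        rw [ha]
        field_simp
        ring

/-- A list of `k` labels misses at least one of the `k + 1` cells cut out by `k` anchors: it is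
`γ`-far from all points of that cell. -/
lemma exists_missed_cell {k : ℕ} {γ : ℝ} (hγ : 0 ≤ γ) (c : Fin k → ℝ)
    (hc : ∀ j j' : Fin k, (j' : ℕ) = j + 1 → c j + 2 * γ ≤ c j') (μ : Fin k → ℝ) :
    ∃ v : Fin (k + 1), ∀ t : ℝ,
      (∀ j : Fin k, ((v : ℕ) = j + 1 → c j + γ ≤ t) ∧ ((v : ℕ) = j → t ≤ c j - γ)) →
      ∀ j, γ ≤ |μ j - t| := by
  classical
  have hmono : Monotone c := by
    cases k with
    | zero => exact fun j => j.elim0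
    | succ n =>
      refine Fin.monotone_iff_le_succ.2 fun i => ?_
      have := hc i.castSucc i.succ (by simp)
      linarith
  -- The number of anchors below an entry is the cell it occupies; `k` entries cannot occupy all `k
  -- + 1` cells. An entry closer than `γ` to a point of cell `v` would have exactly `v` anchors
  -- below it.
  let f : Fin k → Fin (k + 1) := fun l =>
    ⟨({j | c j < μ l} : Finset (Fin k)).card, by
      have := Finset.card_le_univ ({j | c j < μ l} : Finset (Fin k))
      simp at this ⊢
      omega⟩
  have hf : ¬ Function.Surjective f := fun h => by
    have := Fintype.card_le_of_surjective f h
    simp at this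
  obtain ⟨v, hv⟩ := not_forall.1 hf
  refine ⟨v, fun t ht l => ?_⟩
  by_contra! hlt
  rw [abs_lt] at hlt
  refine hv ⟨l, Fin.ext ?_⟩
  have hset : ({j | c j < μ l} : Finset (Fin k)) = ({j | (j : ℕ) < v} : Finset (Fin k)) := by
    ext j
    simp only [Finset.mem_filter, Finset.mem_univ, true_and]
    constructor
    · intro h
      by_contra! hvj
      have h1 := (ht ⟨v, hvj.trans_lt j.2⟩).2 rfl
      have h2 : c ⟨v, hvj.trans_lt j.2⟩ ≤ c j := hmono hvj
      linarith
    · intro h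
      have hv1 : (v : ℕ) - 1 < k := by have := v.2; omega
      have h1 := (ht ⟨v - 1, hv1⟩).1 (by simp; omega)
      have h2 : c j ≤ c ⟨v - 1, hv1⟩ := hmono (show (j : ℕ) ≤ v - 1 by omega)
      linarith
  change ({j | c j < μ l} : Finset (Fin k)).card = v
  rw [hset, Fin.card_filter_val_lt]
  have := v.2
  omega

/-! ### Grid labels and empirical distributions -/

/-- The label `j / N` of the regular grid in `[0,1]`. -/
noncomputable def gridLabel (N : ℕ) (j : Fin (N + 1)) : I :=
  ⟨(j : ℝ) / N, by positivity, div_le_one_of_le₀ (by exact_mod_cast j.is_le) (by positivity)⟩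

lemma exists_gridLabel_close {N : ℕ} (hN : 0 < N) (t : I) :
    ∃ j, |(t : ℝ) - gridLabel N j| ≤ 1 / N := by
  have hN' : (0 : ℝ) < N := by exact_mod_cast hN
  have h0 : 0 ≤ (t : ℝ) * N := mul_nonneg t.2.1 hN'.le
  have hle : ⌊(t : ℝ) * N⌋₊ ≤ N := by
    refine Nat.floor_le_of_le ?_
    nlinarith [t.2.2]
  refine ⟨⟨⌊(t : ℝ) * N⌋₊, by omega⟩, ?_⟩
  have h1 := Nat.floor_le h0
  have h2 := Nat.lt_floor_add_one ((t : ℝ) * N)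
  have : (t : ℝ) - gridLabel N ⟨⌊(t : ℝ) * N⌋₊, by omega⟩ =
      (t * N - ⌊(t : ℝ) * N⌋₊) / N := by
    simp only [gridLabel]
    field_simp
  rw [this, abs_of_nonneg (div_nonneg (by linarith) hN'.le)]
  gcongr
  linarith

lemma listLoss_nonneg {k : ℕ} (μ : Fin k → I) (y : I) : 0 ≤ listLoss μ y :=
  Real.iInf_nonneg fun _ => abs_nonneg _

lemma measurable_listLoss {X : Type*} [MeasurableSpace X] {k : ℕ} {μ : X → Fin k → I}
    (hμ : Measurable μ) : Measurable fun p : X × I => listLoss (μ p.1) p.2 := by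
  unfold listLoss
  refine Measurable.iInf fun j => ?_
  have h1 : Measurable fun p : X × I => ((μ p.1 j : I) : ℝ) :=
    measurable_subtype_coe.comp ((measurable_pi_apply j).comp (hμ.comp measurable_fst))
  have h2 : Measurable fun p : X × I => (p.2 : ℝ) := measurable_subtype_coe.comp measurable_snd
  exact (h1.sub h2).abs

/-- The uniform distribution on `Fin d`. -/
noncomputable def uniformFin (d : ℕ) : Measure (Fin d) := (d : ℝ≥0∞)⁻¹ • Measure.count

lemma isProbabilityMeasure_uniformFin {d : ℕ} (hd : d ≠ 0) :
    IsProbabilityMeasure (uniformFin d) := by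
  constructor
  simp only [uniformFin, Measure.smul_apply, smul_eq_mul, Measure.count_univ,
    ENat.card_eq_coe_fintype_card, Fintype.card_fin]
  exact ENNReal.inv_mul_cancel (by simpa using hd) (by simp)

/-- The error of a measurable list hypothesis under the empirical distribution of a finite sequence
of examples is its average loss. -/
lemma listErr_map_uniformFin {X : Type*} [MeasurableSpace X] {d k : ℕ} (hd : d ≠ 0)
    (g : Fin d → X × I) {μ : X → Fin k → I} (hμ : Measurable μ) :
    listErr ((uniformFin d).map g) μ =
      ENNReal.ofReal ((∑ i, listLoss (μ (g i).1) (g i).2) / d) := by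
  have hd' : (0 : ℝ) < d := by exact_mod_cast Nat.pos_of_ne_zero hd
  rw [listErr, lintegral_map (measurable_listLoss hμ).ennreal_ofReal (measurable_of_finite g),
    uniformFin, lintegral_smul_measure, lintegral_count, tsum_fintype,
    ← ENNReal.ofReal_sum_of_nonneg fun i _ => listLoss_nonneg _ _, div_eq_inv_mul,
    ENNReal.ofReal_mul (by positivity), ENNReal.ofReal_inv_of_pos hd', ENNReal.ofReal_natCast,
    smul_eq_mul]

/-! ### The counting argument -/

/-- Against an empirical distribution of examples, some positions of the sample and some random
seed are bad for few labelings. -/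
lemma exists_positions_seed {X Ω : Type*} [MeasurableSpace X] [MeasurableSpace Ω] {k d m : ℕ}
    (hd : d ≠ 0) {H : Set (X → I)} {P : Measure Ω} [IsProbabilityMeasure P]
    {A : ListAlgorithm X Ω k} {ε δ : ℝ} (hδ : 0 ≤ δ) (hA : AgnosticGuarantee H P A ε δ m)
    {B : Type*} [Fintype B] (g : B → Fin d → X × I) :
    ∃ (s : Fin m → Fin d) (ω : Ω),
      ({b | ¬ listErr ((uniformFin d).map (g b)) (A.output m (fun t => g b (s t)) ω) ≤
        bestErr H ((uniformFin d).map (g b)) + ENNReal.ofReal ε}.ncard : ℝ) ≤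
      Fintype.card B * δ := by
  have := isProbabilityMeasure_uniformFin hd
  let Q : Measure ((Fin m → Fin d) × Ω) := (Measure.pi fun _ => uniformFin d).prod P
  let E : B → Set ((Fin m → Fin d) × Ω) := fun b =>
    {q | ¬ listErr ((uniformFin d).map (g b)) (A.output m (fun t => g b (q.1 t)) q.2) ≤
        bestErr H ((uniformFin d).map (g b)) + ENNReal.ofReal ε}
  have hE : ∀ b, Q (E b) ≤ ENNReal.ofReal δ := by
    intro b
    have hg : Measurable (g b) := measurable_of_finite _
    have hprob : IsProbabilityMeasure ((uniformFin d).map (g b)) :=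
      Measure.isProbabilityMeasure_map hg.aemeasurable
    have hF : Measurable fun (s : Fin m → Fin d) t => g b (s t) := measurable_of_finite _
    have hmap : ((Measure.pi fun _ : Fin m => (uniformFin d).map (g b)).prod P) =
        Q.map (Prod.map (fun (s : Fin m → Fin d) t => g b (s t)) id) := by
      rw [← Measure.map_prod_map _ _ hF measurable_id, Measure.map_id,
        ← Measure.pi_map_pi fun _ => hg.aemeasurable]
    refine le_trans ?_ (hA m le_rfl _ hprob)
    rw [hmap]
    -- This inequality holds for every set, so the failure event need not be measurable.
    exact Measure.le_map_apply (hF.prodMap measurable_id).aemeasurable _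
  obtain ⟨⟨s, ω⟩, h⟩ := exists_card_filter_mem_le Q E hE
  refine ⟨s, ω, ?_⟩
  rw [← ENNReal.ofReal_natCast, ← ENNReal.ofReal_natCast, ← ENNReal.ofReal_mul (by positivity),
    ENNReal.ofReal_le_ofReal_iff (by positivity)] at h
  exact h

/-- The counting inequality: the labelings of a shattered sequence are, up to a `δ`-fraction,
covered by the lists that the algorithm outputs on the `(N + 1) ^ m` possible label sequences. -/
lemma one_sub_le_of_fatShatters {X Ω : Type*} [MeasurableSpace X] [MeasurableSpace Ω] {k d m N : ℕ}
    (hk : 1 ≤ k) (hd : d ≠ 0) {γ : ℝ} (hγ : 0 < γ) {H : Set (X → I)}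
    (hH : ∀ h ∈ H, Measurable h) {P : Measure Ω} [IsProbabilityMeasure P]
    {A : ListAlgorithm X Ω k} {ε δ : ℝ} (hε : 0 ≤ ε) (hδ : 0 ≤ δ)
    (hεγ : ε ≤ γ / (8 * (k + 1))) (hA : AgnosticGuarantee H P A ε δ m)
    (hN : 8 * (k + 1) / γ ≤ N) {x : Fin d → X} (hx : FatShatters H γ k x) :
    1 - δ ≤ (N + 1) ^ m * Real.exp (-(d / (3 * (k + 1)))) := by
  classical
  have hk1 : (2 : ℝ) ≤ k + 1 := by
    have : (1 : ℝ) ≤ k := by exact_mod_cast hk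
    linarith
  have hd' : (0 : ℝ) < d := by exact_mod_cast Nat.pos_of_ne_zero hd
  have hN0 : (0 : ℝ) < N := lt_of_lt_of_le (by positivity) hN
  have hρ : (1 : ℝ) / N ≤ γ / (8 * (k + 1)) := by
    rw [div_le_iff₀ hγ] at hN
    rw [div_le_div_iff₀ hN0 (by positivity)]
    linarith
  obtain ⟨c, hc, hb⟩ := hx
  choose h hhH hh using hb
  choose r hr using fun t => exists_gridLabel_close (N := N) (by exact_mod_cast hN0) t
  let g : (Fin d → Fin (k + 1)) → Fin d → X × I := fun b i => (x i, gridLabel N (r (h b (x i))))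
  obtain ⟨s, ω, hs⟩ := exists_positions_seed hd hδ hA g
  let out : (Fin m → Fin (N + 1)) → X → Fin k → I := fun l =>
    A.output m (fun t => (x (s t), gridLabel N (l t))) ω
  choose v hv using fun l i => exists_missed_cell hγ.le (fun j => (c i j : ℝ)) (hc i)
    (fun j => (out l (x i) j : ℝ))
  let C : (Fin m → Fin (N + 1)) → Set (Fin d → Fin (k + 1)) := fun l =>
    {b | (({i | b i = v l i} : Finset (Fin d)).card : ℝ) ≤ 4 / 15 * (d / (k + 1))}
  set bad : Set (Fin d → Fin (k + 1)) := {b | ¬ listErr ((uniformFin d).map (g b))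
    (A.output m (fun t => g b (s t)) ω) ≤
      bestErr H ((uniformFin d).map (g b)) + ENNReal.ofReal ε} with hbad
  have hcover : badᶜ ⊆ ⋃ l, C l := by
    intro b hb
    simp only [hbad, Set.mem_compl_iff, Set.mem_ofPred_eq, not_not] at hb
    -- The labels seen under `b`: with positions and seed fixed, the output depends on `b` only
    -- through `l`.
    set l : Fin m → Fin (N + 1) := fun t => r (h b (x (s t)))
    refine Set.mem_iUnion.2 ⟨l, ?_⟩
    have hbest : bestErr H ((uniformFin d).map (g b)) ≤ ENNReal.ofReal (1 / N) := by
      refine (iInf₂_le (h b) (hhH b)).trans ?_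
      rw [listErr_map_uniformFin hd _ (measurable_pi_lambda _ fun _ => hH _ (hhH b))]
      refine ENNReal.ofReal_le_ofReal ?_
      rw [div_le_iff₀ hd']
      calc _ ≤ ∑ _i : Fin d, (1 : ℝ) / N := Finset.sum_le_sum fun i _ => by
            simpa [listLoss, g] using hr (h b (x i))
        _ = _ := by simp [mul_comm]
    have herr := hb.trans (add_le_add_left hbest _)
    rw [listErr_map_uniformFin hd _ (A.measurable_output _ _ _),
      ← ENNReal.ofReal_add (by positivity) hε, ENNReal.ofReal_le_ofReal_iff (by positivity),
      div_le_iff₀ hd'] at herr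
    -- The missed cell costs `γ`, and rounding gives back at most `γ / (8 * (k + 1)) ≤ γ / 16`, as
    -- `k ≥ 1`.
    have hloss : ∀ i, b i = v l i → γ * (15 / 16) ≤ listLoss (out l (x i)) (g b i).2 := by
      intro i hi
      have : Nonempty (Fin k) := ⟨⟨0, hk⟩⟩
      refine le_ciInf fun j => ?_
      have h1 := hv l i (h b (x i)) (fun j => by rw [← hi]; exact hh b i j) j
      have h2 := hr (h b (x i))
      have h3 := abs_sub_le (out l (x i) j : ℝ) (gridLabel N (r (h b (x i)))) (h b (x i))
      rw [abs_sub_comm (gridLabel N (r (h b (x i))) : ℝ)] at h3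
      have h4 : γ / (8 * (k + 1)) ≤ γ / 16 := by gcongr; linarith
      change _ ≤ |(out l (x i) j : ℝ) - gridLabel N (r (h b (x i)))|
      linarith
    have hsum : (({i | b i = v l i} : Finset (Fin d)).card : ℝ) * (γ * (15 / 16)) ≤
        ∑ i, listLoss (out l (x i)) (g b i).2 := by
      rw [← nsmul_eq_mul]
      refine (Finset.card_nsmul_le_sum _ _ _ fun i hi => hloss i (Finset.mem_filter.1 hi).2).trans ?_
      exact Finset.sum_le_sum_of_subset_of_nonneg (Finset.subset_univ _)
        fun i _ _ => listLoss_nonneg _ _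
    -- The total loss allowed is `(1 / N + ε) * d ≤ γ * d / (4 * (k + 1))`; at `15 γ / 16` per
    -- agreement this leaves `4 / 15 * (d / (k + 1))` of them.
    have hfin : (({i | b i = v l i} : Finset (Fin d)).card : ℝ) * (γ * (15 / 16)) ≤
        (4 / 15 * (d / (k + 1))) * (γ * (15 / 16)) := by
      refine (hsum.trans herr).trans ?_
      calc (1 / N + ε) * (d : ℝ) ≤ (γ / (8 * (k + 1)) + γ / (8 * (k + 1))) * d := by gcongr
        _ = _ := by field_simp; norm_num
    exact le_of_mul_le_mul_right hfin (by positivity)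
  have hcardC : ((⋃ l, C l).ncard : ℝ) ≤
      (N + 1) ^ m * ((k + 1) ^ d * Real.exp (-(d / (3 * (k + 1))))) := by
    calc ((⋃ l, C l).ncard : ℝ) ≤ ∑ l, ((C l).ncard : ℝ) := by
          have := Finset.set_ncard_biUnion_le Finset.univ C
          simp only [Finset.mem_univ, Set.iUnion_true] at this
          exact_mod_cast this
      _ ≤ ∑ _l : Fin m → Fin (N + 1), ((k + 1 : ℝ) ^ d * Real.exp (-(d / (3 * (k + 1))))) :=
          Finset.sum_le_sum fun l _ => ncard_agreement_le d k (v l)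
      _ = _ := by simp
  have htot : ((k : ℝ) + 1) ^ d ≤ bad.ncard + (⋃ l, C l).ncard := by
    have h1 := Set.ncard_add_ncard_compl bad
    have h2 := Set.ncard_le_ncard hcover (Set.toFinite _)
    have h3 : Nat.card (Fin d → Fin (k + 1)) = (k + 1) ^ d := by simp
    rw [h3] at h1
    have : (k + 1) ^ d ≤ bad.ncard + (⋃ l, C l).ncard := by omega
    exact_mod_cast this
  have hcard : (Fintype.card (Fin d → Fin (k + 1)) : ℝ) = (k + 1) ^ d := by simp
  rw [hcard] at hs
  have hpos : (0 : ℝ) < (k + 1) ^ d := by positivity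
  refine le_of_mul_le_mul_left ?_ hpos
  calc ((k : ℝ) + 1) ^ d * (1 - δ) = (k + 1) ^ d - (k + 1) ^ d * δ := by ring
    _ ≤ (N + 1) ^ m * ((k + 1) ^ d * Real.exp (-(d / (3 * (k + 1))))) := by linarith
    _ = _ := by ring

/-! ### From the count to the sample size -/

/-- The lower bound on the sample size for each shattered sequence. -/
lemma length_le_of_fatShatters {X Ω : Type*} [MeasurableSpace X] [MeasurableSpace Ω] {k d m : ℕ}
    (hk : 1 ≤ k) {γ : ℝ} (hγ : 0 < γ) (hγ1 : γ < 1) {H : Set (X → I)}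
    (hH : ∀ h ∈ H, Measurable h) {P : Measure Ω} [IsProbabilityMeasure P]
    {A : ListAlgorithm X Ω k} {ε δ : ℝ} (hε : 0 ≤ ε) (hδ : 0 ≤ δ)
    (hεγ : ε ≤ γ / (8 * (k + 1))) (hδγ : δ ≤ γ / (8 * (k + 1)))
    (hA : AgnosticGuarantee H P A ε δ m) {x : Fin d → X} (hx : FatShatters H γ k x) :
    (d : ℝ) ≤ 30 * (k : ℝ) ^ k * m * Real.log (2 + d * k / γ) := by
  have hkR : (1 : ℝ) ≤ k := by exact_mod_cast hk
  have hlog0 : 0 ≤ Real.log (2 + d * k / γ) :=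
    Real.log_nonneg (le_add_of_le_of_nonneg one_le_two (by positivity))
  rcases Nat.eq_zero_or_pos d with rfl | hd
  · simp only [Nat.cast_zero] at hlog0 ⊢
    positivity
  have hdR : (1 : ℝ) ≤ d := by exact_mod_cast hd
  have key := one_sub_le_of_fatShatters hk hd.ne' hγ hH hε hδ hεγ hA (Nat.le_ceil _) hx
  set N := ⌈8 * ((k : ℝ) + 1) / γ⌉₊
  have hδ1 : δ ≤ 1 / (8 * (k + 1)) := hδγ.trans (by gcongr)
  set y : ℝ := 1 / (3 * (k + 1)) with hy
  have hy0 : 0 < y := by positivity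
  have hy1 : y ≤ 1 / 6 := by rw [hy]; gcongr; linarith
  have hδy : δ ≤ 3 / 8 * y := hδ1.trans_eq (by rw [hy]; field_simp)
  have hdy : (d : ℝ) / (3 * (k + 1)) = d * y := by rw [hy]; ring
  rw [hdy] at key
  have key2 : (1 - δ) * Real.exp (d * y) ≤ (N + 1) ^ m := by
    calc (1 - δ) * Real.exp (d * y)
        ≤ (N + 1) ^ m * Real.exp (-(d * y)) * Real.exp (d * y) := by gcongr
      _ = _ := by rw [mul_assoc, ← Real.exp_add]; simp
  -- Without examples the count reads `(1 - δ) * exp (d * y) ≤ 1`, which fails for `d ≥ 1` because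
  -- `δ ≤ 3 / 8 * y`.
  rcases Nat.eq_zero_or_pos m with rfl | hm
  · exfalso
    rw [pow_zero] at key2
    have h1 : 1 + y ≤ Real.exp (d * y) := by
      have := Real.add_one_le_exp (d * y)
      nlinarith
    have h2 : (1 - 3 / 8 * y) * (1 + y) ≤ (1 - δ) * Real.exp (d * y) := by
      gcongr
      linarith
    nlinarith
  set z : ℝ := d * k / γ with hz
  have hkz : k / γ ≤ z := by rw [hz]; gcongr; nlinarith
  have hz1 : 1 ≤ z := by
    refine le_trans ?_ hkz
    rw [le_div_iff₀ hγ]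
    linarith
  have hNz : (N : ℝ) + 1 ≤ 18 * z := by
    have h1 : (N : ℝ) < 8 * (k + 1) / γ + 1 := Nat.ceil_lt_add_one (by positivity)
    have h2 : 8 * ((k : ℝ) + 1) / γ ≤ 16 * (k / γ) := by
      rw [← mul_div_assoc, div_le_div_iff_of_pos_right hγ]
      linarith
    linarith
  -- Since `1 - δ ≥ 1 / 2`, a factor `2` is lost; `m ≥ 1` absorbs it into the base.
  have h36 : Real.exp (d * y) ≤ (36 * z) ^ m := by
    have h1 : (1 / 2 : ℝ) * Real.exp (d * y) ≤ (N + 1) ^ m := by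
      refine le_trans ?_ key2
      gcongr
      linarith
    calc Real.exp (d * y) ≤ 2 * (N + 1 : ℝ) ^ m := by linarith
      _ ≤ 2 ^ m * (18 * z) ^ m := by
          gcongr
          exact le_self_pow₀ (by norm_num) hm.ne'
      _ = _ := by rw [← mul_pow]; ring
  have hlog3 : 1 ≤ Real.log (2 + z) := by
    rw [Real.le_log_iff_exp_le (by linarith)]
    have := Real.exp_one_lt_d9
    norm_num at this
    linarith
  have hlog36 : Real.log (36 * z) ≤ 5 * Real.log (2 + z) := by
    have : 36 * z ≤ (2 + z) ^ 5 := by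
      have h81 : (81 : ℝ) ≤ (2 + z) ^ 4 := by
        calc (81 : ℝ) = 3 ^ 4 := by norm_num
          _ ≤ _ := by gcongr; linarith
      nlinarith
    calc Real.log (36 * z) ≤ Real.log ((2 + z) ^ 5) := Real.log_le_log (by linarith) this
      _ = _ := by rw [Real.log_pow]; norm_num
  have hdm : d * y ≤ m * (5 * Real.log (2 + z)) := by
    have := (Real.le_log_iff_exp_le (by positivity)).2 h36
    rw [Real.log_pow] at this
    refine this.trans ?_
    gcongr
  -- The argument controls `d / (k + 1)`; only this crude comparison brings in `k ^ k`.
  have hkk : (k : ℝ) + 1 ≤ 2 * (k : ℝ) ^ k := by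
    have := le_self_pow₀ hkR (by omega : k ≠ 0)
    linarith
  calc (d : ℝ) = 3 * (k + 1) * (d * y) := by rw [hy]; field_simp
    _ ≤ 3 * (2 * (k : ℝ) ^ k) * (m * (5 * Real.log (2 + z))) := by gcongr
    _ = _ := by ring

/-! ### Finiteness of the dimension -/

/-- If the lengths of the shattered sequences are bounded, the dimension is finite, and attained
unless it is `0`. -/
lemma exists_fatDim_eq {X : Type*} {H : Set (X → I)} {γ : ℝ} {k : ℕ} {N : ℕ}
    (hN : ∀ (d : ℕ) (x : Fin d → X), FatShatters H γ k x → d ≤ N) :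
    ∃ d : ℕ, fatDim H γ k = d ∧ (d = 0 ∨ ∃ x : Fin d → X, FatShatters H γ k x) := by
  let S : Set ℕ := {d | ∃ x : Fin d → X, FatShatters H γ k x}
  have hS : BddAbove S := ⟨N, fun d ⟨x, hx⟩ => hN d x hx⟩
  rcases S.eq_empty_or_nonempty with h | h
  · refine ⟨0, ?_, Or.inl rfl⟩
    refine le_antisymm (iSup₂_le fun d hd => ?_) (zero_le)
    exact absurd (show d ∈ S from hd) (by simp [h])
  · have hmem : sSup S ∈ S := Nat.sSup_mem h hS
    refine ⟨sSup S, le_antisymm (iSup₂_le fun d hd => ?_) ?_, Or.inr hmem⟩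
    · exact_mod_cast le_csSup hS hd
    · exact le_iSup₂ (f := fun (d : ℕ) (_ : ∃ x : Fin d → X, FatShatters H γ k x) => (d : ℕ∞))
        (sSup S) hmem

/-- Linear growth beats logarithmic growth: `log u ≤ 2 * √u` turns the hypothesis into `d ^ 2 =
O(d)`. It makes the dimension finite, hence attained or `0`, so that the sample bound can be applied
at `d` itself. -/
lemma exists_bound_of_le_mul_log (a b : ℝ) (ha : 0 ≤ a) (hb : 0 ≤ b) :
    ∃ N : ℕ, ∀ d : ℕ, (d : ℝ) ≤ a * Real.log (2 + d * b) → d ≤ N := by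
  refine ⟨⌈4 * a ^ 2 * (2 + b)⌉₊, fun d hd => ?_⟩
  rcases Nat.eq_zero_or_pos d with rfl | hd0
  · exact Nat.zero_le _
  have hd1 : (1 : ℝ) ≤ d := by exact_mod_cast hd0
  have hu : 0 < 2 + d * b := by positivity
  have hlog : Real.log (2 + d * b) ≤ 2 * √(2 + d * b) := by
    have h1 := Real.log_le_sub_one_of_pos (Real.sqrt_pos.2 hu)
    rw [Real.log_sqrt hu.le] at h1
    linarith
  have h2 : (d : ℝ) ≤ a * (2 * √(2 + d * b)) := hd.trans (by gcongr)
  have h3 : (d : ℝ) ^ 2 ≤ 4 * a ^ 2 * (2 + d * b) := by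
    calc (d : ℝ) ^ 2 ≤ (a * (2 * √(2 + d * b))) ^ 2 := by gcongr
      _ = 4 * a ^ 2 * (√(2 + d * b)) ^ 2 := by ring
      _ = _ := by rw [Real.sq_sqrt hu.le]
  have h4 : 4 * a ^ 2 * (2 + d * b) ≤ 4 * a ^ 2 * (2 + b) * d := by
    rw [mul_assoc _ (2 + b)]
    gcongr
    nlinarith
  have h5 : (d : ℝ) ≤ 4 * a ^ 2 * (2 + b) := by nlinarith
  have h6 := Nat.le_ceil (4 * a ^ 2 * (2 + b))
  exact_mod_cast (show (d : ℝ) ≤ ⌈4 * a ^ 2 * (2 + b)⌉₊ from h5.trans h6)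

end ListRegression

theorem mainTheorem2 :
    ∃ c : ℝ, 0 < c ∧ ∃ p : ℕ,
      ∀ (X : Type*) [MeasurableSpace X] (H : Set (X → I)) (_ : ∀ h ∈ H, Measurable h)
        (k : ℕ) (_ : 1 ≤ k) (γ : ℝ) (_ : 0 < γ) (_ : γ < 1)
        (Ω : Type*) [MeasurableSpace Ω] (P : Measure Ω) [IsProbabilityMeasure P]
        (A : ListRegression.ListAlgorithm X Ω k)
        (ε δ : ℝ) (_ : 0 < ε) (_ : ε < 1) (_ : 0 < δ) (_ : δ < 1)
        (_ : ε ≤ γ / (8 * (k + 1))) (_ : δ ≤ γ / (8 * (k + 1)))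
        (m : ℕ) (_ : ListRegression.AgnosticGuarantee H P A ε δ m),
        ∃ d : ℕ, ListRegression.fatDim H γ k = d ∧
          c * (d / (k : ℝ) ^ k) / Real.log (2 + d * k / γ) ^ p ≤ m := by
  -- Here `30 = 3 * 2 * 5`: the Chernoff exponent, `k + 1 ≤ 2 * k ^ k`, and `log (36 * z) ≤ 5 * log
  -- (2 + z)`. One logarithm suffices.
  refine ⟨1 / 30, by norm_num, 1, ?_⟩
  intro X _ H hH k hk γ hγ hγ1 Ω _ P _ A ε δ hε _ hδ _ hεγ hδγ m hA
  have bound : ∀ (d : ℕ) (x : Fin d → X), ListRegression.FatShatters H γ k x →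
      (d : ℝ) ≤ 30 * (k : ℝ) ^ k * m * Real.log (2 + d * k / γ) := fun d x hx =>
    ListRegression.length_le_of_fatShatters hk hγ hγ1 hH hε.le hδ.le hεγ hδγ hA hx
  obtain ⟨N, hN⟩ := ListRegression.exists_bound_of_le_mul_log (30 * (k : ℝ) ^ k * m) (k / γ)
    (by positivity) (by positivity)
  obtain ⟨d, hd, h⟩ := ListRegression.exists_fatDim_eq
    fun d x hx => hN d (by simpa only [mul_div_assoc] using bound d x hx)
  refine ⟨d, hd, ?_⟩
  have hle : (d : ℝ) ≤ 30 * (k : ℝ) ^ k * m * Real.log (2 + d * k / γ) := by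
    rcases h with rfl | ⟨x, hx⟩
    · have : 0 ≤ Real.log (2 + ((0 : ℕ) : ℝ) * k / γ) := Real.log_nonneg (by norm_num)
      rw [Nat.cast_zero] at this ⊢
      positivity
    · exact bound d x hx
  have hlog : 0 < Real.log (2 + d * k / γ) :=
    Real.log_pos (lt_add_of_lt_of_nonneg one_lt_two (by positivity))
  have hkk : (0 : ℝ) < (k : ℝ) ^ k := by positivity
  rw [pow_one, div_le_iff₀ hlog, mul_div_assoc', div_le_iff₀ hkk]
  linarith
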